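/- **Theorem 1 (regret bound of AdamCB).** *Problem.* Let $1\le K<n$, $d,T\ge 1$, and let $\ell_1,\dots,\ell_n:\mathbb R^d\to\mathbb R$ be convex and differentiable, $f=\frac1n\sum_{i=1}^n\ell_i$, and let $\theta^*$ be a minimizer of $f$ on $\mathbb R^d$. *Algorithm.* Inputs: $\alpha,\varepsilon,L>0$, $\beta_1,\beta_2\in[0,1)$, $\lambda,\gamma\in(0,1)$, the batch size $K$ and a starting point $\theta_1$. Put $\alpha_t=\alpha/\sqrt t$, $\beta_{1,t}=\beta_1\lambda^{t-1}$, $m_0=v_0=0\in\mathbb R^d$, $w_{i,0}=1$. Round $t=1,\dots,T$ is as follows. 1. (Capping.) Let $c=\frac{1/K-\gamma/n}{1-\gamma}$. If $\max_i w_{i,t-1}\ge c\sum_i w_{i,t-1}$, go through the weights in descending order $\bar w_1\ge\bar w_2\ge\dots\ge\bar w_n$, form $\tau_i=c\,\bigl(\sum_{k\ge i}\bar w_k\bigr)/(1-(i-1)c)$ and stop at the first $i$ with $\bar w_i<\tau_i$; let $\tau=\tau_i$ and $S_t=\{i:w_{i,t-1}\ge\tau\}$. Otherwise $S_t=\emptyset$.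 Let $w'_i=\tau$ for $i\in S_t$ and $w'_i=w_{i,t-1}$ for the other $i$. 2. (Selection.) Let $q_{i,t}=(1-\gamma)\frac{w'_i}{\sum_j w'_j}+\frac{\gamma}{n}$ and $p_{i,t}=Kq_{i,t}$, so that $\sum_ip_{i,t}=K$, and draw a set $J_t$ of $K$ distinct samples by dependent rounding (DepRound) of $p_t$: as long as $p$ has entries in $(0,1)$, choose two of them, at distinct positions $i,j$ (by an arbitrary fixed rule), let $a=\min(1-p^i,p^j)$, $b=\min(p^i,1-p^j)$, and replace $(p^i,p^j)$ by $(p^i+a,p^j-a)$ with probability $\frac{b}{a+b}$ and by $(p^i-b,p^j+b)$ with probability $\frac{a}{a+b}$; finally $J_t=\{i:p^i=1\}$. 3. (Adam step, coordinatewise.) With $g_{i,t}=\nabla\ell_i(\theta_t)$, let $g_t=\frac1K\sum_{j\in J_t}\frac{g_{j,t}}{n\,q_{j,t}}$, $m_t=\beta_{1,t}m_{t-1}+(1-\beta_{1,t})g_t$, $v_t=\beta_2v_{t-1}+(1-\beta_2)g_t^2$, $\hat v_1=v_1$, $\hat v_t=\max\{\frac{(1-\beta_{1,t})^2}{(1-\beta_{1,t-1})^2}\hat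 v_{t-1},v_t\}$ for $t\ge2$, and $\theta_{t+1}=\theta_t-\alpha_t\,m_t/(\sqrt{\hat v_t}+\varepsilon)$. 4. (Weights.) With $p_{\min}=K\gamma/n$, let $\ell_{j,t}=\frac{p_{\min}^2}{L^2}\bigl(-\frac{\|g_{j,t}\|^2}{p_{j,t}^2}+\frac{L^2}{p_{\min}^2}\bigr)$ for $j\in J_t$ and $\ell_{j,t}=0$ for $j\notin J_t$. Let $w_{j,t}=w_{j,t-1}\exp(-K\gamma\ell_{j,t}/n)$ for $j\notin S_t$ and $w_{j,t}=w_{j,t-1}$ for $j\in S_t$. *Claim.* For all $\alpha,\varepsilon,L,D>0$, $\beta_1,\beta_2\in[0,1)$ and $\lambda,\gamma\in(0,1)$ there is a constant $C>0$ that depends only on these numbers (not on $d,n,K,T$, the losses, the starting point or the choices in the dependent rounding) such that the following holds. If, on every run of positive probability, $\|g_{i,t}\|\le L$ for all $i\in[n]$, $t\in[T]$ and $\|\theta_s-\theta_t\|\le D$ for all $s,t\in[T]$, and if also $\|\theta_1-\theta^*\|\le D$, then $$\mathbb E\Bigl[\sum_{t=1}^Tf(\theta_t)-T\min_{\theta\in\mathbb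 R^d}f(\theta)\Bigr]\le C\left(d\sqrt T+\frac{\sqrt d}{n^{3/4}}\Bigl(\frac TK\ln\frac nK\Bigr)^{1/4}\right).$$ -/

import Mathlib

namespace AdamCB

noncomputable section

open scoped Classical

/-- The parameter space `ℝ^d` with its Euclidean norm. -/
abbrev Space (d : ℕ) : Type := EuclideanSpace ℝ (Fin d)

/-! ### Dependent rounding -/

/-- The coin that shows `true` with probability `x`. -/
def coin (x : ℝ) (h0 : 0 ≤ x) (h1 : x ≤ 1) : PMF Bool :=
  PMF.ofFintype (fun b => ENNReal.ofReal (if b then x else 1 - x)) (by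
    rw [Fintype.sum_bool, ← ENNReal.ofReal_add] <;> simp [h0, h1])

/-- The coordinate `i` of `p` lies strictly between `0` and `1`. -/
def IsFractional {n : ℕ} (p : Fin n → ℝ) (i : Fin n) : Prop := 0 < p i ∧ p i < 1

/-- `(i, j)` is a pair of distinct fractional coordinates of `p`. -/
def IsFractionalPair {n : ℕ} (p : Fin n → ℝ) (ij : Fin n × Fin n) : Prop :=
  ij.1 ≠ ij.2 ∧ IsFractional p ij.1 ∧ IsFractional p ij.2

/-- A rule that chooses, whenever this is possible, two distinct fractional coordinates. -/
structure PairRule (n : ℕ) where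
  /-- the chosen pair -/
  pick : (Fin n → ℝ) → Fin n × Fin n
  /-- the chosen pair is admissible as soon as an admissible pair exists -/
  valid : ∀ p, (∃ ij, IsFractionalPair p ij) → IsFractionalPair p (pick p)

/-- The vector `p` after its coordinates `i` and `j` have been replaced by `a` and `b`. -/
def replacePair {n : ℕ} (p : Fin n → ℝ) (i j : Fin n) (a b : ℝ) : Fin n → ℝ :=
  Function.update (Function.update p i a) j b

theorem card_fractional_replacePair_lt {n : ℕ} (p : Fin n → ℝ) (ij : Fin n × Fin n)
    (h : IsFractionalPair p ij) (a b : ℝ) (hab : ¬ (0 < a ∧ a < 1) ∨ ¬ (0 < b ∧ b < 1)) :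
    (Finset.univ.filter (IsFractional (replacePair p ij.1 ij.2 a b))).card <
      (Finset.univ.filter (IsFractional p)).card := by
  obtain ⟨i, j⟩ := ij
  obtain ⟨hne, hi, hj⟩ := h
  simp only at hne hi hj
  apply Finset.card_lt_card
  refine (Finset.ssubset_iff_of_subset ?_).2 ?_
  · intro k hk
    simp only [Finset.mem_filter, Finset.mem_univ, true_and] at hk ⊢
    by_cases hkj : k = j
    · exact hkj ▸ hj
    · by_cases hki : k = i
      · exact hki ▸ hi
      · simpa [IsFractional, replacePair, hkj, hki] using hk
  · rcases hab with ha | hb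
    · refine ⟨i, by simpa using hi, fun hm => ha ?_⟩
      simpa [IsFractional, replacePair, hne] using (Finset.mem_filter.1 hm).2
    · refine ⟨j, by simpa using hj, fun hm => hb ?_⟩
      simpa [IsFractional, replacePair] using (Finset.mem_filter.1 hm).2

/-- The law of the random subset returned by dependent rounding of the vector `p`. While there are
two distinct fractional coordinates `i, j`, put `a = min (1 - p i) (p j)` and
`b = min (p i) (1 - p j)`, and replace `(p i, p j)` by `(p i + a, p j - a)` with probability
`b / (a + b)` and by `(p i - b, p j + b)` with probability `a / (a + b)`. At the end return
`{i | p i = 1}`. For a vector with entries in `[0, 1]` and integer sum, the existence of one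
fractional coordinate is the same as the existence of two, and the sum is the size of the
returned set. -/
def depRound {n : ℕ} (rule : PairRule n) (p : Fin n → ℝ) : PMF (Finset (Fin n)) :=
  if h : IsFractionalPair p (rule.pick p) then
    let i := (rule.pick p).1
    let j := (rule.pick p).2
    let a := min (1 - p i) (p j)
    let b := min (p i) (1 - p j)
    have ha : 0 < a := lt_min (by have := h.2.1.2; simp only [i]; linarith) h.2.2.1
    have hb : 0 < b := lt_min h.2.1.1 (by have := h.2.2.2; simp only [j]; linarith)
    (coin (b / (a + b)) (by positivity) (by rw [div_le_one (by positivity)]; linarith)).bind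
      fun up =>
        if up then depRound rule (replacePair p i j (p i + a) (p j - a))
        else depRound rule (replacePair p i j (p i - b) (p j + b))
  else PMF.pure (Finset.univ.filter fun i => p i = 1)
termination_by (Finset.univ.filter (IsFractional p)).card
decreasing_by
  · apply card_fractional_replacePair_lt p _ h
    rcases min_choice (1 - p i) (p j) with h' | h'
    · left; intro hx; simp only [i, j] at hx h'; linarith [hx.2]
    · right; intro hx; simp only [i, j] at hx h'; linarith [hx.1]
  · apply card_fractional_replacePair_lt p _ h
    rcases min_choice (p i) (1 - p j) with h' | h'
    · left; intro hx; simp only [i, j] at hx h'; linarith [hx.1]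
    · right; intro hx; simp only [i, j] at hx h'; linarith [hx.2]

/-! ### Batch selection -/

/-- The constant `(1/K - γ/n) / (1 - γ)`: a sample with normalised weight at most this constant
is selected with probability at most one. -/
def capConst (n K : ℕ) (γ : ℝ) : ℝ := (1 / (K : ℝ) - γ / n) / (1 - γ)

/-- The loop that computes the threshold `τ`. It runs through the weights in descending order;
when `i` weights have been passed and `S` is the sum of the others, the candidate is
`τ = c * S / (1 - i * c)`, and the loop stops as soon as the next weight is below it. The last
argument is the current value of `τ`. -/
def thresholdLoop (c : ℝ) : ℕ → ℝ → List ℝ → ℝ → ℝ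
  | _, _, [], τ => τ
  | i, S, x :: xs, _ =>
      let τ := c * S / (1 - i * c)
      if x < τ then τ else thresholdLoop c (i + 1) (S - x) xs τ

/-- The threshold `τ` for the weights `w`. -/
def threshold {n : ℕ} (c : ℝ) (w : Fin n → ℝ) : ℝ :=
  thresholdLoop c 0 (∑ i, w i) ((Finset.univ.val.map w).sort (· ≥ ·)) 0

/-- The set `S_null` of the samples with capped weight; it is empty unless the largest weight is
at least `c` times the sum of the weights. -/
def nullSet {n : ℕ} (c : ℝ) (w : Fin n → ℝ) : Finset (Fin n) :=
  if ∃ i, c * ∑ j, w j ≤ w i then Finset.univ.filter fun i => threshold c w ≤ w i else ∅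

/-- The capped weights. -/
def cappedWeight {n : ℕ} (c : ℝ) (w : Fin n → ℝ) (i : Fin n) : ℝ :=
  if i ∈ nullSet c w then threshold c w else w i

/-- The sampling distribution over the dataset (it sums to one):
`q i = (1 - γ) w' i / ∑ w' + γ / n` with the capped weights `w'`. -/
def sampleDist {n : ℕ} (K : ℕ) (γ : ℝ) (w : Fin n → ℝ) (i : Fin n) : ℝ :=
  (1 - γ) * (cappedWeight (capConst n K γ) w i / ∑ j, cappedWeight (capConst n K γ) w j) + γ / n

/-- The selection probabilities `p i = K q i` (they sum to `K`). -/
def selectProb {n : ℕ} (K : ℕ) (γ : ℝ) (w : Fin n → ℝ) (i : Fin n) : ℝ :=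
  K * sampleDist K γ w i

/-! ### Objective and gradient estimate -/

/-- The empirical risk `f(θ) = (1/n) ∑ ℓ i θ` over the full dataset, where `ℓ i` is the loss of
the `i`-th sample as a function of the parameter. -/
def empiricalRisk {d n : ℕ} (ℓ : Fin n → Space d → ℝ) (θ : Space d) : ℝ :=
  (1 / (n : ℝ)) * ∑ i, ℓ i θ

/-- The importance-weighted mini-batch gradient
`(1/K) ∑_{j ∈ J} ∇ℓ j (θ) / (n q j)`, an unbiased estimate of `∇f(θ)` when `j` belongs to `J` with
probability `K q j`. -/
def gradEstimate {d n : ℕ} (K : ℕ) (ℓ : Fin n → Space d → ℝ) (q : Fin n → ℝ)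
    (J : Finset (Fin n)) (θ : Space d) : Space d :=
  (1 / (K : ℝ)) • ∑ j ∈ J, (1 / ((n : ℝ) * q j)) • gradient (ℓ j) θ

/-! ### Weight update -/

/-- The bandit loss of the sample `j`:
`(p_min² / L²) (-‖g j‖² / (p j)² + L² / p_min²)` on the batch, where `p_min = K γ / n`, and zero
off the batch. -/
def banditLoss {d n : ℕ} (K : ℕ) (γ L : ℝ) (p : Fin n → ℝ) (g : Fin n → Space d)
    (J : Finset (Fin n)) (j : Fin n) : ℝ :=
  let pmin : ℝ := K * γ / n
  if j ∈ J then pmin ^ 2 / L ^ 2 * (-(‖g j‖ ^ 2 / p j ^ 2) + L ^ 2 / pmin ^ 2) else 0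

/-- The updated weights; the weights of the samples in `S` (the capped ones) are kept. -/
def weightUpdate {d n : ℕ} (K : ℕ) (γ L : ℝ) (w p : Fin n → ℝ) (g : Fin n → Space d)
    (J S : Finset (Fin n)) (j : Fin n) : ℝ :=
  if j ∈ S then w j else w j * Real.exp (-(K * γ * banditLoss K γ L p g J j / n))

/-! ### The algorithm -/

/-- The inputs of the algorithm: step sizes `α_t = α / √t`, first-moment decay rates
`β_{1,t} = β₁ λ^(t-1)`, second-moment decay rate `β₂`, exploration parameter `γ`, stabiliser `ε`,
gradient bound `L` (used in the bandit losses) and batch size `K`. -/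
structure Hyper where
  α : ℝ
  β₁ : ℝ
  β₂ : ℝ
  lam : ℝ
  γ : ℝ
  ε : ℝ
  L : ℝ
  K : ℕ

/-- The step size `α_t`, for `t ≥ 1`. -/
def Hyper.step (P : Hyper) (t : ℕ) : ℝ := P.α / √(t : ℝ)

/-- The decay rate `β_{1,t}`, for `t ≥ 1`. -/
def Hyper.decay (P : Hyper) (t : ℕ) : ℝ := P.β₁ * P.lam ^ (t - 1)

/-- The state after `t` rounds: the parameter `θ_{t+1}`, the moment estimates `m_t`, `v_t`,
`v̂_t`, and the sample weights `w_t`. -/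
structure State (d n : ℕ) where
  θ : Space d
  m : Space d
  v : Fin d → ℝ
  vhat : Fin d → ℝ
  w : Fin n → ℝ

/-- The initial state. -/
def initState {d : ℕ} (n : ℕ) (θ₁ : Space d) : State d n where
  θ := θ₁
  m := 0
  v := 0
  vhat := 0
  w := fun _ => 1

/-- Round `t ≥ 1` of the algorithm, when the batch `J` is selected in it. -/
def doRound {d n : ℕ} (P : Hyper) (ℓ : Fin n → Space d → ℝ) (t : ℕ) (s : State d n)
    (J : Finset (Fin n)) : State d n :=
  let g : Space d := gradEstimate P.K ℓ (sampleDist P.K P.γ s.w) J s.θ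
  let m : Space d := P.decay t • s.m + (1 - P.decay t) • g
  let v : Fin d → ℝ := fun u => P.β₂ * s.v u + (1 - P.β₂) * g u ^ 2
  let vhat : Fin d → ℝ := fun u =>
    if t = 1 then v u
    else max ((1 - P.decay t) ^ 2 / (1 - P.decay (t - 1)) ^ 2 * s.vhat u) (v u)
  { θ := WithLp.toLp 2 fun u => s.θ u - P.step t * (m u / (√(vhat u) + P.ε))
    m := m
    v := v
    vhat := vhat
    w := weightUpdate P.K P.γ P.L s.w (selectProb P.K P.γ s.w) (fun j => gradient (ℓ j) s.θ) J
      (nullSet (capConst n P.K P.γ) s.w) }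

/-- The state after `t` rounds, when `J` lists the batches selected in them. -/
def stateAfter {d n : ℕ} (P : Hyper) (ℓ : Fin n → Space d → ℝ) (θ₁ : Space d) :
    (t : ℕ) → (Fin t → Finset (Fin n)) → State d n
  | 0, _ => initState n θ₁
  | t + 1, J => doRound P ℓ (t + 1) (stateAfter P ℓ θ₁ t fun i => J i.castSucc) (J (Fin.last t))

/-- The joint law of the batches of the first `t` rounds: given the earlier batches, the batch of
a round is drawn by dependent rounding of the current selection probabilities. -/
def batchLaw {d n : ℕ} (P : Hyper) (ℓ : Fin n → Space d → ℝ) (θ₁ : Space d) (rule : PairRule n) :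
    (t : ℕ) → PMF (Fin t → Finset (Fin n))
  | 0 => PMF.pure Fin.elim0
  | t + 1 => (batchLaw P ℓ θ₁ rule t).bind fun J =>
      (depRound rule (selectProb P.K P.γ (stateAfter P ℓ θ₁ t J).w)).map fun B =>
        Fin.snoc (α := fun _ => Finset (Fin n)) J B

/-- The iterates: `iterate P ℓ θ₁ J s` is `θ_{s+1}`, `0 ≤ s < T`, on the run with batches `J`. -/
def iterate {d n T : ℕ} (P : Hyper) (ℓ : Fin n → Space d → ℝ) (θ₁ : Space d)
    (J : Fin T → Finset (Fin n)) (s : Fin T) : Space d :=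
  (stateAfter P ℓ θ₁ s fun i => J (Fin.castLE s.isLt.le i)).θ

/-- The cumulative regret against the full-dataset optimum,
`𝔼[∑_{t ≤ T} f(θ_t) - T min f]`, over the randomness of the batches. -/
def regret {d n : ℕ} (P : Hyper) (ℓ : Fin n → Space d → ℝ) (θ₁ : Space d) (rule : PairRule n)
    (T : ℕ) : ℝ :=
  ∑ J : Fin T → Finset (Fin n), (batchLaw P ℓ θ₁ rule T J).toReal *
    (∑ s, empiricalRisk ℓ (iterate P ℓ θ₁ J s) - T * ⨅ θ, empiricalRisk ℓ θ)

/-- On every run of `T` rounds that has positive probability, all per-sample gradients at the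
iterates are bounded by `L`. -/
def BoundedGradients {d n : ℕ} (P : Hyper) (ℓ : Fin n → Space d → ℝ) (θ₁ : Space d)
    (rule : PairRule n) (T : ℕ) (L : ℝ) : Prop :=
  ∀ J ∈ (batchLaw P ℓ θ₁ rule T).support, ∀ (s : Fin T) (i : Fin n),
    ‖gradient (ℓ i) (iterate P ℓ θ₁ J s)‖ ≤ L

/-- On every run of `T` rounds that has positive probability, the iterates have mutual distances
at most `D`. -/
def BoundedIterates {d n : ℕ} (P : Hyper) (ℓ : Fin n → Space d → ℝ) (θ₁ : Space d)
    (rule : PairRule n) (T : ℕ) (D : ℝ) : Prop :=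
  ∀ J ∈ (batchLaw P ℓ θ₁ rule T).support, ∀ s t : Fin T,
    ‖iterate P ℓ θ₁ J s - iterate P ℓ θ₁ J t‖ ≤ D

end

end AdamCB

namespace AdamCB

open scoped Classical RealInnerProductSpace

/-! The first term of the bound, `d √T`, already dominates the regret; the second is nonnegative and
is added for free. This is possible because the constant may depend on `γ`. Exploration keeps every
`q i` at least `γ / n`, so a batch of `K` samples gives a gradient estimate of norm at most `L / γ`,
whatever the weights are (`norm_gradEstimate_le`). No estimate of the bandit losses is needed: the
weights enter only through their positivity.

The randomness is removed by unbiasedness. Capping makes the selection probabilities lie in `[0, 1]`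
with sum `K`; each step of dependent rounding preserves the sum and, on average, every coordinate,
so sample `i` is selected with probability `K q i` (`depRound_spec`). Convexity bounds the regret by
the correlation of the full gradients with `θ_t - θ*`, and in expectation the full gradients may be
replaced by their estimates, since `θ_t` is determined by the earlier batches
(`expect_sum_inner_runGrad`).

What remains is a deterministic bound along each run, one coordinate at a time
(`momentum_regret_le`). It telescopes a potential whose coefficient `√t (√v̂_t + ε) / (2α)` is
non-decreasing. The squared steps are controlled by `ε` alone and sum to `O(√T)`; momentum costs a
convergent geometric series because `β_{1,t}` decays. Of `v̂` only monotonicity and boundedness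
matter (`vhat_spec`). -/

/-! ### Capping of the weights -/

/-- The loop stops at the fixed point of `τ ↦ c * ∑ min x τ`, up to the terms already passed. -/
theorem thresholdLoop_spec {c : ℝ} (hc : 0 < c) :
    ∀ (l : List ℝ) (i : ℕ) (S τ₀ : ℝ), l.Pairwise (· ≥ ·) → (∀ x ∈ l, 0 < x) → S = l.sum →
      0 < 1 - i * c → 1 < (l.length + i) * c →
      0 < thresholdLoop c i S l τ₀ ∧
      c * (l.map fun x => min x (thresholdLoop c i S l τ₀)).sum =
        thresholdLoop c i S l τ₀ * (1 - i * c) := by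
  intro l
  induction l with
  -- The two bounds on `c` contradict each other once all weights have been passed, so the loop
  -- stops earlier and the default `τ₀` is never returned.
  | nil => intro i S τ₀ _ _ _ h1 h2; simp at h2; linarith
  | cons x xs ih =>
    intro i S τ₀ hs hpos hS h1 h2
    rw [List.pairwise_cons] at hs
    obtain ⟨hx, hs⟩ := hs
    rw [List.sum_cons] at hS
    simp only [thresholdLoop]
    split_ifs with hlt
    · have hm : (List.map (fun y => min y (c * S / (1 - i * c))) (x :: xs)) = x :: xs := by
        conv_rhs => rw [← List.map_id (x :: xs)]
        refine List.map_congr_left fun y hy => ?_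
        rcases List.mem_cons.1 hy with rfl | hy
        · exact min_eq_left hlt.le
        · exact min_eq_left ((hx y hy).trans hlt.le)
      rw [hm, List.sum_cons, ← hS, div_mul_cancel₀ _ h1.ne']
      exact ⟨(hpos x (by simp)).trans hlt, rfl⟩
    · have hle : c * S ≤ x * (1 - i * c) := by
        rwa [not_lt, div_le_iff₀ h1] at hlt
      have hx0 : 0 < x := hpos x (by simp)
      have hxs0 : ∀ y ∈ xs, 0 < y := fun y hy => hpos y (by simp [hy])
      have hle' : c * xs.sum ≤ x * (1 - (i + 1) * c) := by rw [hS] at hle; linarith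
      -- Failure of the stopping test is what keeps the next denominator positive. With no weight
      -- left, it would contradict the length bound instead.
      have h1' : 0 < 1 - ((i + 1 : ℕ) : ℝ) * c := by
        push_cast
        rcases eq_or_ne xs [] with rfl | hne
        · simp at hle' h2
          nlinarith [nonneg_of_mul_nonneg_right hle' hx0]
        · exact pos_of_mul_pos_right (lt_of_lt_of_le (mul_pos hc
            (List.sum_pos xs hxs0 hne)) hle') hx0.le
      obtain ⟨hτ0, key⟩ := ih (i + 1) (S - x) (c * S / (1 - i * c)) hs hxs0 (by linarith) h1' (by
        simp only [List.length_cons] at h2; push_cast at h2 ⊢; linarith)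
      set τ := thresholdLoop c (i + 1) (S - x) xs (c * S / (1 - i * c))
      -- A final `τ` above `x` would cap none of the remaining weights; the equation for `τ` would
      -- then contradict `hle'`. Hence the weight just passed is indeed capped at `τ`.
      have hτx : τ ≤ x := by
        by_contra! hcon
        have hm : xs.map (fun y => min y τ) = xs := by
          conv_rhs => rw [← List.map_id xs]
          exact List.map_congr_left fun y hy => min_eq_left ((hx y hy).trans hcon.le)
        rw [hm] at key
        push_cast at key h1'
        nlinarith [mul_lt_mul_of_pos_right hcon h1']
      refine ⟨hτ0, ?_⟩
      rw [List.map_cons, List.sum_cons, min_eq_right hτx, mul_add, key]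
      push_cast
      ring

theorem threshold_spec {n : ℕ} {c : ℝ} (hc : 0 < c) (hn : 1 < n * c) {w : Fin n → ℝ}
    (hw : ∀ i, 0 < w i) :
    0 < threshold c w ∧ c * ∑ i, min (w i) (threshold c w) = threshold c w := by
  have h := thresholdLoop_spec hc ((Finset.univ.val.map w).sort (· ≥ ·)) 0 (∑ i, w i) 0
    (Multiset.pairwise_sort _ _) (by
      intro x hx
      rw [Multiset.mem_sort, Multiset.mem_map] at hx
      obtain ⟨i, -, rfl⟩ := hx
      exact hw i) (by rw [← Multiset.sum_coe, Multiset.sort_eq]; rfl) (by simp) (by simpa using hn)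
  rw [← Multiset.sum_coe, ← Multiset.map_coe, Multiset.sort_eq, Multiset.map_map] at h
  simpa [threshold, Function.comp_def, -Fin.univ_val_map] using h

theorem capConst_pos {n K : ℕ} {γ : ℝ} (hK : 1 ≤ K) (hKn : K < n) (hγ' : γ < 1) :
    0 < capConst n K γ := by
  have hK0 : (0 : ℝ) < K := by exact_mod_cast hK
  have hKn' : (K : ℝ) < n := by exact_mod_cast hKn
  refine div_pos (sub_pos.2 ?_) (by linarith)
  rw [div_lt_div_iff₀ (by linarith) hK0]
  nlinarith

/-- The product equals `(n / K - γ) / (1 - γ)`, so this is exactly `K < n`. It is the condition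
under which the threshold loop terminates at a fixed point. -/
theorem one_lt_mul_capConst {n K : ℕ} {γ : ℝ} (hK : 1 ≤ K) (hKn : K < n) (hγ' : γ < 1) :
    1 < n * capConst n K γ := by
  have hK0 : (0 : ℝ) < K := by exact_mod_cast hK
  have hKn' : (K : ℝ) < n := by exact_mod_cast hKn
  have hn0 : (0 : ℝ) < n := hK0.trans hKn'
  have h1 : 1 < (n : ℝ) / K := (one_lt_div hK0).2 hKn'
  rw [capConst, ← mul_div_assoc, one_lt_div (by linarith), mul_sub, mul_one_div,
    mul_div_cancel₀ _ hn0.ne']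
  linarith

theorem cappedWeight_pos {n : ℕ} {c : ℝ} (hc : 0 < c) (hn : 1 < n * c) {w : Fin n → ℝ}
    (hw : ∀ i, 0 < w i) (i : Fin n) : 0 < cappedWeight c w i := by
  unfold cappedWeight
  split_ifs with h
  · exact (threshold_spec hc hn hw).1
  · exact hw i

/-- When capping is active the capped weights are `min (w i) τ`, and the fixed-point equation
identifies the right-hand side with `τ`. Otherwise the failed test is the claim. -/
theorem cappedWeight_le {n : ℕ} {c : ℝ} (hc : 0 < c) (hn : 1 < n * c) {w : Fin n → ℝ}
    (hw : ∀ i, 0 < w i) (i : Fin n) : cappedWeight c w i ≤ c * ∑ j, cappedWeight c w j := by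
  by_cases h : ∃ i, c * ∑ j, w j ≤ w i
  · have hm : ∀ j, cappedWeight c w j = min (w j) (threshold c w) := by
      intro j
      simp only [cappedWeight, nullSet, if_pos h, Finset.mem_filter, Finset.mem_univ, true_and]
      split_ifs with hj
      · exact (min_eq_right hj).symm
      · exact (min_eq_left (not_le.1 hj).le).symm
    simp only [hm, (threshold_spec hc hn hw).2]
    exact min_le_right _ _
  · have hm : ∀ j, cappedWeight c w j = w j := by
      intro j; simp [cappedWeight, nullSet, if_neg h]
    push Not at h
    simp only [hm]
    exact (h i).le

theorem sampleDist_ge {n K : ℕ} {γ : ℝ} (hK : 1 ≤ K) (hKn : K < n) (hγ' : γ < 1)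
    {w : Fin n → ℝ} (hw : ∀ i, 0 < w i) (i : Fin n) : γ / n ≤ sampleDist K γ w i := by
  have h := cappedWeight_pos (capConst_pos hK hKn hγ') (one_lt_mul_capConst hK hKn hγ') hw
  exact le_add_of_nonneg_left (mul_nonneg (by linarith)
    (div_nonneg (h i).le (Finset.sum_nonneg fun j _ => (h j).le)))

theorem sum_sampleDist {n K : ℕ} {γ : ℝ} (hK : 1 ≤ K) (hKn : K < n) (hγ' : γ < 1)
    {w : Fin n → ℝ} (hw : ∀ i, 0 < w i) : ∑ i, sampleDist K γ w i = 1 := by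
  have h := cappedWeight_pos (capConst_pos hK hKn hγ') (one_lt_mul_capConst hK hKn hγ') hw
  have hn : 0 < n := by omega
  have : Nonempty (Fin n) := ⟨⟨0, hn⟩⟩
  have hn0 : (n : ℝ) ≠ 0 := by exact_mod_cast hn.ne'
  have hs := Finset.sum_pos (fun j _ => h j) Finset.univ_nonempty
  simp only [sampleDist, Finset.sum_add_distrib, ← Finset.mul_sum, ← Finset.sum_div,
    div_self hs.ne', Finset.sum_const, Finset.card_univ, Fintype.card_fin, nsmul_eq_mul]
  field_simp
  ring

/-- The constant `c` is chosen so that `(1 - γ) c + γ / n = 1 / K`. -/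
theorem selectProb_le_one {n K : ℕ} {γ : ℝ} (hK : 1 ≤ K) (hKn : K < n) (hγ' : γ < 1)
    {w : Fin n → ℝ} (hw : ∀ i, 0 < w i) (i : Fin n) : selectProb K γ w i ≤ 1 := by
  have hc := capConst_pos hK hKn hγ'
  have hn := one_lt_mul_capConst hK hKn hγ'
  have h := cappedWeight_pos hc hn hw
  have hK0 : (0 : ℝ) < K := by exact_mod_cast hK
  have hs := Finset.sum_pos (fun j _ => h j) ⟨i, Finset.mem_univ i⟩
  have h1 : cappedWeight (capConst n K γ) w i / ∑ j, cappedWeight (capConst n K γ) w j ≤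
      capConst n K γ := (div_le_iff₀ hs).2 (cappedWeight_le hc hn hw i)
  have h2 : (1 - γ) * capConst n K γ = 1 / K - γ / n := by
    rw [capConst, mul_div_cancel₀ _ (by linarith)]
  calc selectProb K γ w i ≤ K * ((1 - γ) * capConst n K γ + γ / n) := by
        unfold selectProb sampleDist
        gcongr
    _ = 1 := by rw [h2, sub_add_cancel, mul_one_div_cancel hK0.ne']

/-! ### Expectations over finite types -/

/-- The expectation of `φ` under the law `μ` on a finite type. -/
noncomputable def expect {A : Type*} [Fintype A] (μ : PMF A) (φ : A → ℝ) : ℝ :=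
  ∑ a, (μ a).toReal * φ a

theorem expect_pure {A : Type*} [Fintype A] (a : A) (φ : A → ℝ) :
    expect (PMF.pure a) φ = φ a := by
  rw [expect, Finset.sum_eq_single a] <;> simp +contextual [PMF.pure_apply]

theorem expect_bind {A B : Type*} [Fintype A] [Fintype B] (μ : PMF A) (κ : A → PMF B)
    (φ : B → ℝ) : expect (μ.bind κ) φ = expect μ fun a => expect (κ a) φ := by
  have h : ∀ b, ((μ.bind κ) b).toReal = ∑ a, (μ a).toReal * (κ a b).toReal := by
    intro b
    rw [PMF.bind_apply, tsum_fintype, ENNReal.toReal_sum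
      fun a _ => ENNReal.mul_ne_top (μ.apply_ne_top a) ((κ a).apply_ne_top b)]
    simp [ENNReal.toReal_mul]
  simp only [expect, h, Finset.sum_mul, Finset.mul_sum]
  rw [Finset.sum_comm]
  simp only [mul_assoc]

theorem expect_map {A B : Type*} [Fintype A] [Fintype B] (μ : PMF A) (f : A → B) (φ : B → ℝ) :
    expect (μ.map f) φ = expect μ fun a => φ (f a) := by
  simp [PMF.map, expect_bind, expect_pure]

theorem expect_const {A : Type*} [Fintype A] (μ : PMF A) (c : ℝ) :
    expect μ (fun _ => c) = c := by
  have h : ∑ a, (μ a).toReal = 1 := by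
    rw [← ENNReal.toReal_sum fun a _ => μ.apply_ne_top a, ← tsum_fintype (L := .unconditional _), μ.tsum_coe,
      ENNReal.toReal_one]
  rw [expect, ← Finset.sum_mul, h, one_mul]

theorem expect_add {A : Type*} [Fintype A] (μ : PMF A) (φ ψ : A → ℝ) :
    expect μ (fun a => φ a + ψ a) = expect μ φ + expect μ ψ := by
  simp [expect, mul_add, Finset.sum_add_distrib]

theorem expect_mul_left {A : Type*} [Fintype A] (μ : PMF A) (c : ℝ) (φ : A → ℝ) :
    expect μ (fun a => c * φ a) = c * expect μ φ := by
  simp [expect, Finset.mul_sum, mul_left_comm]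

theorem expect_sum {A ι : Type*} [Fintype A] (μ : PMF A) (s : Finset ι) (φ : ι → A → ℝ) :
    expect μ (fun a => ∑ i ∈ s, φ i a) = ∑ i ∈ s, expect μ (φ i) := by
  simp only [expect, Finset.mul_sum]
  exact Finset.sum_comm

/-- Comparison on the support suffices, which matters because gradients and iterates are bounded
only on runs of positive probability. -/
theorem expect_mono {A : Type*} [Fintype A] (μ : PMF A) {φ ψ : A → ℝ}
    (h : ∀ a ∈ μ.support, φ a ≤ ψ a) : expect μ φ ≤ expect μ ψ := by
  refine Finset.sum_le_sum fun a _ => ?_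
  by_cases ha : a ∈ μ.support
  · exact mul_le_mul_of_nonneg_left (h a ha) ENNReal.toReal_nonneg
  · rw [PMF.mem_support_iff, not_not] at ha
    simp [ha]

theorem expect_coin (x : ℝ) (h0 : 0 ≤ x) (h1 : x ≤ 1) (φ : Bool → ℝ) :
    expect (coin x h0 h1) φ = x * φ true + (1 - x) * φ false := by
  simp [expect, coin, ENNReal.toReal_ofReal, h0, h1]

/-! ### Dependent rounding -/

theorem sum_replacePair {n : ℕ} (p : Fin n → ℝ) {i j : Fin n} (hij : i ≠ j) {a b : ℝ}
    (hab : a + b = p i + p j) : ∑ k, replacePair p i j a b k = ∑ k, p k := by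
  have h : ∀ k, replacePair p i j a b k =
      p k + ((if k = i then a - p i else 0) + if k = j then b - p j else 0) := by
    intro k
    by_cases hj : k = j
    · subst hj; simp [replacePair, hij.symm]
    · by_cases hi : k = i
      · subst hi; simp [replacePair, hij]
      · simp [replacePair, hi, hj]
  simp only [h, Finset.sum_add_distrib, Finset.sum_ite_eq', Finset.mem_univ, if_true]
  linarith

theorem replacePair_mem {n : ℕ} {p : Fin n → ℝ} {i j : Fin n} {a b : ℝ} {s : Set ℝ}
    (hp : ∀ k, p k ∈ s) (ha : a ∈ s) (hb : b ∈ s) (k : Fin n) : replacePair p i j a b k ∈ s := by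
  by_cases hj : k = j
  · subst hj; simpa [replacePair]
  · by_cases hi : k = i
    · subst hi; simpa [replacePair, hj]
    · simpa [replacePair, hi, hj] using hp k

/-- A single fractional coordinate would equal `K` minus a sum of zeros and ones, an integer
strictly between `0` and `1`. -/
theorem eq_zero_or_one_of_not_fractionalPair {n K : ℕ} {p : Fin n → ℝ}
    (hp : ∀ i, p i ∈ Set.Icc (0 : ℝ) 1) (hs : ∑ i, p i = K)
    (h : ¬ ∃ ij, IsFractionalPair p ij) (i : Fin n) : p i = 0 ∨ p i = 1 := by
  have hdich : ∀ k, ¬ IsFractional p k → p k = 0 ∨ p k = 1 := by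
    intro k hk
    rcases (hp k).1.eq_or_lt with h0 | h0
    · exact Or.inl h0.symm
    · exact Or.inr ((hp k).2.eq_or_lt.resolve_right fun h1 => hk ⟨h0, h1⟩)
  refine hdich i fun hi => ?_
  have hoth : ∀ k ∈ Finset.univ.erase i, p k = ((if p k = 1 then 1 else 0 : ℤ) : ℝ) := by
    intro k hk
    rcases hdich k fun hk' => h ⟨(k, i), Finset.ne_of_mem_erase hk, hk', hi⟩ with h' | h' <;>
      simp [h']
  rw [← Finset.add_sum_erase _ _ (Finset.mem_univ i), Finset.sum_congr rfl hoth,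
    ← Int.cast_sum] at hs
  set z : ℤ := ∑ k ∈ Finset.univ.erase i, if p k = 1 then 1 else 0
  have e : p i = ((K - z : ℤ) : ℝ) := by push_cast; linarith
  have h1 := hi.1
  have h2 := hi.2
  rw [e] at h1 h2
  have h3 : (0 : ℤ) < K - z := by exact_mod_cast h1
  have h4 : (K - z : ℤ) < 1 := by exact_mod_cast h2
  omega

/-- Dependent rounding of a vector with entries in `[0, 1]` and sum `K` returns a set of `K`
elements that contains `i` with probability `p i`. -/
theorem depRound_spec {n K : ℕ} (rule : PairRule n) (p : Fin n → ℝ) :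
    (∀ i, p i ∈ Set.Icc (0 : ℝ) 1) → ∑ i, p i = K →
      (∀ J ∈ (depRound rule p).support, J.card = K) ∧
      ∀ i, expect (depRound rule p) (fun J => if i ∈ J then 1 else 0) = p i := by
  induction p using depRound.induct rule with
  | case1 p h i j a b ha hb ih₁ ih₂ =>
    intro hp hs
    have hij : i ≠ j := h.1
    have ha1 : a ≤ 1 - p i := min_le_left _ _
    have ha2 : a ≤ p j := min_le_right _ _
    have hb1 : b ≤ p i := min_le_left _ _
    have hb2 : b ≤ 1 - p j := min_le_right _ _
    have hi := hp i
    have hj := hp j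
    obtain ⟨c₁, e₁⟩ := ih₁ (replacePair_mem hp ⟨by linarith [hi.1], by linarith⟩
      ⟨by linarith, by linarith [hj.2]⟩) (by rw [sum_replacePair p hij (by ring), hs])
    obtain ⟨c₂, e₂⟩ := ih₂ (replacePair_mem hp ⟨by linarith, by linarith [hi.2]⟩
      ⟨by linarith [hj.1], by linarith⟩) (by rw [sum_replacePair p hij (by ring), hs])
    rw [depRound, dif_pos h]
    refine ⟨fun J hJ => ?_, fun k => ?_⟩
    · rw [PMF.mem_support_bind_iff] at hJ
      obtain ⟨up, -, hJ⟩ := hJ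
      cases up
      · exact c₂ J (by simpa using hJ)
      · exact c₁ J (by simpa using hJ)
    · rw [expect_bind, expect_coin]
      simp only [if_true, Bool.false_eq_true, if_false]
      rw [e₁, e₂]
      have hab : a + b ≠ 0 := by positivity
      -- The changes `+a` and `-b` have probabilities `b / (a + b)` and `a / (a + b)`, so their mean
      -- is zero.
      change b / (a + b) * replacePair p i j _ _ k + (1 - b / (a + b)) * replacePair p i j _ _ k
        = p k
      by_cases hkj : k = j
      · subst hkj
        simp [replacePair]
        field_simp
        ring
      · by_cases hki : k = i
        · subst hki
          simp [replacePair, hij]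
          field_simp
          ring
        · simp [replacePair, hki, hkj]
          ring
  | case2 p h =>
    intro hp hs
    have h01 := eq_zero_or_one_of_not_fractionalPair hp hs fun hex => h (rule.valid p hex)
    have hval : ∀ i, (if p i = 1 then (1 : ℝ) else 0) = p i := by
      intro i; rcases h01 i with h | h <;> simp [h]
    rw [depRound, dif_neg h]
    refine ⟨fun J hJ => ?_, fun i => ?_⟩
    · rw [PMF.support_pure, Set.mem_singleton_iff] at hJ
      subst hJ
      have : ((Finset.univ.filter fun i => p i = 1).card : ℝ) = K := by
        rw [← hs, Finset.card_filter]
        push_cast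
        exact Finset.sum_congr rfl fun i _ => hval i
      exact_mod_cast this
    · simp [expect_pure, hval]

/-! ### The scalar Adam recursion -/

theorem sum_inv_sqrt_le (T : ℕ) : ∑ s ∈ Finset.range T, 1 / √((s : ℝ) + 1) ≤ 2 * √(T : ℝ) := by
  induction T with
  | zero => simp
  | succ T ih =>
    rw [Finset.sum_range_succ]
    push_cast
    have h0 : 0 ≤ √(T : ℝ) := Real.sqrt_nonneg _
    have h1 : 0 < √((T : ℝ) + 1) := Real.sqrt_pos.2 (by positivity)
    have e0 : √(T : ℝ) ^ 2 = T := Real.sq_sqrt (by positivity)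
    have e1 : √((T : ℝ) + 1) ^ 2 = T + 1 := Real.sq_sqrt (by positivity)
    have : 1 / √((T : ℝ) + 1) ≤ 2 * √((T : ℝ) + 1) - 2 * √(T : ℝ) := by
      rw [div_le_iff₀ h1]
      nlinarith [sq_nonneg (√((T : ℝ) + 1) - √(T : ℝ))]
    linarith

theorem sum_pow_le {r : ℝ} (h0 : 0 ≤ r) (h1 : r < 1) (T : ℕ) :
    ∑ s ∈ Finset.range T, r ^ s ≤ 1 / (1 - r) := by
  rw [one_div, ← tsum_geometric_of_lt_one h0 h1]
  exact (summable_geometric_of_lt_one h0 h1).sum_le_tsum _ fun i _ => pow_nonneg h0 i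

theorem abs_moment_le {T : ℕ} {G : ℝ} (hG : 0 ≤ G) {b g m : ℕ → ℝ} (hb0 : ∀ t, 0 ≤ b t)
    (hb1 : ∀ t, b t ≤ 1) (hm0 : m 0 = 0)
    (hm : ∀ t, m (t + 1) = b t * m t + (1 - b t) * g t) (hg : ∀ t < T, |g t| ≤ G) :
    ∀ t ≤ T, |m t| ≤ G := by
  intro t
  induction t with
  | zero => intro _; simpa [hm0]
  | succ t ih =>
    intro ht
    have h1 := abs_le.1 (ih (by omega))
    have h2 := abs_le.1 (hg t (by omega))
    rw [hm, abs_le]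
    constructor <;> nlinarith [hb0 t, hb1 t]

/-- The regret of a preconditioned gradient method with momentum, in one dimension. The
preconditioner is the non-decreasing sequence `A`. -/
theorem momentum_regret_le {T : ℕ} {α ε G R β r V y : ℝ} (hα : 0 < α) (hε : 0 < ε) (hG : 0 ≤ G)
    (hR : 0 ≤ R) (hβ0 : 0 ≤ β) (hβ1 : β < 1) (hr0 : 0 < r) (hr1 : r < 1)
    {x m g A : ℕ → ℝ} (hm0 : m 0 = 0)
    (hm : ∀ t, m (t + 1) = β * r ^ t * m t + (1 - β * r ^ t) * g t)
    (hx : ∀ t, x (t + 1) = x t - α / √((t : ℝ) + 1) * (m (t + 1) / A (t + 1)))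
    (hA : Monotone A) (hAε : ∀ t, ε ≤ A t) (hAV : A T ≤ V)
    (hg : ∀ t < T, |g t| ≤ G) (hxy : ∀ t < T, |x t - y| ≤ R) :
    ∑ t ∈ Finset.range T, g t * (x t - y) ≤
      √(T : ℝ) * V / (2 * α) * R ^ 2 + α * G ^ 2 / ε * √(T : ℝ) +
        2 * G * R * (β * (1 / (1 - r))) := by
  have hb0 : ∀ t, 0 ≤ β * r ^ t := fun t => by positivity
  have hb1 : ∀ t, β * r ^ t ≤ 1 := fun t =>
    mul_le_one₀ hβ1.le (by positivity) (pow_le_one₀ hr0.le hr1.le)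
  have hmG := abs_moment_le hG hb0 hb1 hm0 hm hg
  have hA0 : ∀ t, 0 < A t := fun t => hε.trans_le (hAε t)
  -- Summation by parts in potential form. The point `x T` may be far from `y`, but its distance
  -- enters only with a negative sign.
  have hpot : ∀ N ≤ T, ∑ t ∈ Finset.range N, g t * (x t - y) ≤
      √(N : ℝ) * A N / (2 * α) * (R ^ 2 - (x N - y) ^ 2) +
        ∑ t ∈ Finset.range N, (α * G ^ 2 / (2 * ε) * (1 / √((t : ℝ) + 1)) +
          2 * G * R * (β * r ^ t)) := by
    intro N
    induction N with
    | zero => intro _; simp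
    | succ N ih =>
      intro hN
      have ih := ih (by omega)
      rw [Finset.sum_range_succ, Finset.sum_range_succ]
      push_cast
      have hs : 0 < √((N : ℝ) + 1) := Real.sqrt_pos.2 (by positivity)
      set s := √((N : ℝ) + 1) with hsdef
      have hx' := hx N
      rw [← hsdef] at hx'
      set M := m (N + 1)
      set a := A (N + 1)
      have ha : 0 < a := hA0 _
      have hMG : |M| ≤ G := hmG _ hN
      have hsq : (x N - y) ^ 2 ≤ R ^ 2 := by
        rw [← sq_abs]; exact pow_le_pow_left₀ (abs_nonneg _) (hxy N (by omega)) 2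
      have hM2 : M ^ 2 ≤ G ^ 2 := by
        rw [← sq_abs]; exact pow_le_pow_left₀ (abs_nonneg _) hMG 2
      -- The coefficient may grow because it multiplies a nonnegative quantity.
      have hmono : √(N : ℝ) * A N / (2 * α) * (R ^ 2 - (x N - y) ^ 2) ≤
          s * a / (2 * α) * (R ^ 2 - (x N - y) ^ 2) := by
        have h1 : √(N : ℝ) ≤ s := Real.sqrt_le_sqrt (by linarith)
        have h2 : A N ≤ a := hA (Nat.le_succ N)
        have h3 := (hA0 N).le
        exact mul_le_mul_of_nonneg_right (by gcongr) (by linarith)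
      -- This is the square of the update `x (N + 1) - y = (x N - y) - α M / (s a)`, expanded.
      have hstep : M * (x N - y) = s * a / (2 * α) * ((x N - y) ^ 2 - (x (N + 1) - y) ^ 2) +
          α * M ^ 2 / (2 * a) * (1 / s) := by
        rw [hx']
        field_simp
        ring
      have hquad : α * M ^ 2 / (2 * a) * (1 / s) ≤ α * G ^ 2 / (2 * ε) * (1 / s) := by
        have := hAε (N + 1)
        gcongr
      -- Replacing the gradient by the momentum leaves an error with the summable factor `β r ^ N`.
      have hgm : g N * (x N - y) = M * (x N - y) + β * r ^ N * ((g N - m N) * (x N - y)) := by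
        simp only [M, hm]; ring
      have hmom : (g N - m N) * (x N - y) ≤ 2 * G * R := by
        refine (le_abs_self _).trans ?_
        rw [abs_mul]
        refine mul_le_mul ?_ (hxy N (by omega)) (abs_nonneg _) (by positivity)
        linarith [abs_sub (g N) (m N), hg N (by omega), hmG N (by omega)]
      have hmom' := mul_le_mul_of_nonneg_left hmom (hb0 N)
      rw [hgm, hstep]
      linarith
  have h1 := hpot T le_rfl
  rw [Finset.sum_add_distrib, ← Finset.mul_sum, ← Finset.mul_sum, ← Finset.mul_sum] at h1
  have h2 : α * G ^ 2 / (2 * ε) * ∑ t ∈ Finset.range T, 1 / √((t : ℝ) + 1) ≤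
      α * G ^ 2 / ε * √(T : ℝ) := by
    calc _ ≤ α * G ^ 2 / (2 * ε) * (2 * √(T : ℝ)) := by gcongr; exact sum_inv_sqrt_le T
      _ = _ := by field_simp
  have h3 : 2 * G * R * (β * ∑ t ∈ Finset.range T, r ^ t) ≤ 2 * G * R * (β * (1 / (1 - r))) := by
    gcongr
    exact sum_pow_le hr0.le hr1 T
  have h4 : √(T : ℝ) * A T / (2 * α) * (R ^ 2 - (x T - y) ^ 2) ≤
      √(T : ℝ) * V / (2 * α) * R ^ 2 := by
    have := hA0 T
    have hV : 0 ≤ V := this.le.trans hAV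
    calc _ ≤ √(T : ℝ) * A T / (2 * α) * R ^ 2 := by gcongr; linarith [sq_nonneg (x T - y)]
      _ ≤ _ := by gcongr
  linarith

/-- The corrected second moments of Adam: they are non-decreasing, and bounded in terms of a bound
on the gradients. -/
theorem vhat_spec {β r β₂ : ℝ} (hβ0 : 0 ≤ β) (hβ1 : β < 1) (hr0 : 0 < r)
    (hr1 : r < 1) (hβ₂ : 0 ≤ β₂) (hβ₂' : β₂ < 1) {g v vhat : ℕ → ℝ} (hv0 : v 0 = 0)
    (hv : ∀ t, v (t + 1) = β₂ * v t + (1 - β₂) * g t ^ 2) (hvh0 : vhat 0 = 0)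
    (hvh : ∀ t, vhat (t + 1) = if t = 0 then v (t + 1) else
      max ((1 - β * r ^ t) ^ 2 / (1 - β * r ^ (t - 1)) ^ 2 * vhat t) (v (t + 1))) :
    Monotone vhat ∧ ∀ (T : ℕ) (G : ℝ), (∀ t < T, |g t| ≤ G) → vhat T ≤ (G / (1 - β)) ^ 2 := by
  have hv_nonneg : ∀ t, 0 ≤ v t := by
    intro t
    induction t with
    | zero => rw [hv0]
    | succ t ih => rw [hv]; have : 0 ≤ 1 - β₂ := by linarith
                   positivity
  have hnonneg : ∀ t, 0 ≤ vhat t := by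
    intro t
    cases t with
    | zero => rw [hvh0]
    | succ t =>
      rw [hvh]
      split_ifs
      · exact hv_nonneg _
      · exact le_max_of_le_right (hv_nonneg _)
  have hd : ∀ t, 1 - β ≤ 1 - β * r ^ t := fun t => by
    have := mul_le_of_le_one_right hβ0 (pow_le_one₀ hr0.le hr1.le : r ^ t ≤ 1)
    linarith
  have hd0 : ∀ t, 0 < 1 - β * r ^ t := fun t => by linarith [hd t]
  refine ⟨monotone_nat_of_le_succ fun t => ?_, fun T G hg => ?_⟩
  · rw [hvh]
    split_ifs with h
    · subst h; rw [hvh0]; exact hv_nonneg _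
    -- The correction ratio is at least one because the decay rates decrease.
    · refine le_max_of_le_left (le_mul_of_one_le_left (hnonneg t) ?_)
      rw [one_le_div (by have := hd0 (t - 1); positivity)]
      have : r ^ t ≤ r ^ (t - 1) := pow_le_pow_of_le_one hr0.le hr1.le (Nat.sub_le _ _)
      have := hd0 (t - 1)
      gcongr
  · have hvG : ∀ t ≤ T, v t ≤ G ^ 2 := by
      intro t
      induction t with
      | zero => intro _; rw [hv0]; positivity
      | succ t ih =>
        intro ht
        have h1 := ih (by omega)
        have h2 : g t ^ 2 ≤ G ^ 2 := by
          rw [← sq_abs (g t)]; exact pow_le_pow_left₀ (abs_nonneg _) (hg t (by omega)) 2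
        rw [hv]
        nlinarith
    have hstep : ∀ t, v (t + 1) ≤ G ^ 2 →
        v (t + 1) ≤ (1 - β * r ^ t) ^ 2 * (G / (1 - β)) ^ 2 := by
      intro t h
      refine h.trans ?_
      rw [div_pow, ← mul_div_assoc, le_div_iff₀ (by have : 0 < 1 - β := by linarith
                                                    positivity), mul_comm]
      have : 0 ≤ 1 - β := by linarith
      have := hd t
      gcongr
    -- Divided by the squared factor `1 - β r ^ t`, the recursion becomes a running maximum, so the
    -- ratios do not accumulate.
    have key : ∀ t < T, vhat (t + 1) ≤ (1 - β * r ^ t) ^ 2 * (G / (1 - β)) ^ 2 := by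
      intro t
      induction t with
      | zero => intro ht; rw [hvh, if_pos rfl]; exact hstep 0 (hvG 1 ht)
      | succ t ih =>
        intro ht
        rw [hvh, if_neg (Nat.succ_ne_zero t), Nat.add_sub_cancel]
        refine max_le ?_ (hstep _ (hvG _ ht))
        have h0 := hd0 t
        calc _ ≤ (1 - β * r ^ (t + 1)) ^ 2 / (1 - β * r ^ t) ^ 2 *
              ((1 - β * r ^ t) ^ 2 * (G / (1 - β)) ^ 2) := by
              gcongr
              exact ih (by omega)
          _ = _ := by field_simp
    cases T with
    | zero => rw [hvh0]; positivity
    | succ T =>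
      refine (key T (Nat.lt_succ_self T)).trans (mul_le_of_le_one_left (by positivity) ?_)
      have := hd0 T
      refine pow_le_one₀ this.le ?_
      have : 0 ≤ β * r ^ T := by positivity
      linarith

/-! ### Convexity and the gradient estimate -/

/-- On the line through `x` and `y` this compares a derivative at `0` with the slope over `[0, 1]`
of a convex function of one variable. -/
theorem sub_le_inner_gradient {E : Type*} [NormedAddCommGroup E] [InnerProductSpace ℝ E]
    [CompleteSpace E] {f : E → ℝ} (hf : ConvexOn ℝ Set.univ f) {x : E}
    (hd : DifferentiableAt ℝ f x) (y : E) : f x - f y ≤ ⟪gradient f x, x - y⟫ := by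
  have hline : ConvexOn ℝ Set.univ (f ∘ AffineMap.lineMap (k := ℝ) x y) :=
    hf.comp_affineMap (AffineMap.lineMap (k := ℝ) x y)
  have hder : HasDerivAt (f ∘ AffineMap.lineMap (k := ℝ) x y) ⟪gradient f x, y - x⟫ 0 := by
    have h1 : HasFDerivAt f (InnerProductSpace.toDual ℝ E (gradient f x))
        (AffineMap.lineMap (k := ℝ) x y 0) := by
      rw [AffineMap.lineMap_apply_zero]
      exact hd.hasGradientAt.hasFDerivAt
    simpa using h1.comp_hasDerivAt (0 : ℝ) AffineMap.hasDerivAt_lineMap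
  have h := hline.le_slope_of_hasDerivAt (Set.mem_univ 0) (Set.mem_univ 1) one_pos hder
  rw [slope_def_field] at h
  simp only [Function.comp_apply, AffineMap.lineMap_apply_one, AffineMap.lineMap_apply_zero,
    sub_zero, div_one] at h
  rw [← neg_sub y x, inner_neg_right]
  linarith

theorem empiricalRisk_sub_le {d n : ℕ} {ℓ : Fin n → Space d → ℝ}
    (hc : ∀ i, ConvexOn ℝ Set.univ (ℓ i)) (hd : ∀ i, Differentiable ℝ (ℓ i)) (x y : Space d) :
    empiricalRisk ℓ x - empiricalRisk ℓ y ≤ 1 / (n : ℝ) * ∑ i, ⟪gradient (ℓ i) x, x - y⟫ := by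
  rw [empiricalRisk, empiricalRisk, ← mul_sub, ← Finset.sum_sub_distrib]
  gcongr with i
  exact sub_le_inner_gradient (hc i) (hd i x) y

/-- The inclusion probability `K q i` cancels the importance weight `1 / (K n q i)`. Only marginals
matter, so the dependence within a batch is harmless. -/
theorem expect_gradEstimate {d n K : ℕ} {γ : ℝ} (rule : PairRule n) (hK : 1 ≤ K) (hKn : K < n)
    (hγ : 0 < γ) (hγ' : γ < 1) {w : Fin n → ℝ} (hw : ∀ i, 0 < w i) (ℓ : Fin n → Space d → ℝ)
    (θ x : Space d) :
    expect (depRound rule (selectProb K γ w))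
      (fun J => ⟪gradEstimate K ℓ (sampleDist K γ w) J θ, x⟫) =
        1 / (n : ℝ) * ∑ i, ⟪gradient (ℓ i) θ, x⟫ := by
  have hK0 : (0 : ℝ) < K := by exact_mod_cast hK
  have hn0 : (0 : ℝ) < n := hK0.trans (by exact_mod_cast hKn)
  have hq : ∀ i, 0 < sampleDist K γ w i := fun i =>
    (div_pos hγ hn0).trans_le (sampleDist_ge hK hKn hγ' hw i)
  have hp : ∀ i, selectProb K γ w i ∈ Set.Icc (0 : ℝ) 1 := fun i =>
    ⟨mul_nonneg hK0.le (hq i).le, selectProb_le_one hK hKn hγ' hw i⟩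
  have hs : ∑ i, selectProb K γ w i = K := by
    simp only [selectProb, ← Finset.mul_sum, sum_sampleDist hK hKn hγ' hw, mul_one]
  have hmarg := (depRound_spec rule _ hp hs).2
  have hJ : ∀ J : Finset (Fin n), ⟪gradEstimate K ℓ (sampleDist K γ w) J θ, x⟫ =
      ∑ i, (1 / K * (1 / (n * sampleDist K γ w i)) * ⟪gradient (ℓ i) θ, x⟫) *
        (if i ∈ J then 1 else 0) := by
    intro J
    simp only [gradEstimate, inner_smul_left, sum_inner, mul_ite, mul_one, mul_zero,
      Finset.sum_ite_mem, Finset.univ_inter, Finset.mul_sum, mul_assoc]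
    rfl
  simp only [hJ]
  rw [expect_sum, Finset.mul_sum]
  refine Finset.sum_congr rfl fun i _ => ?_
  rw [expect_mul_left, hmarg, selectProb]
  have := (hq i).ne'
  field_simp

theorem card_eq_of_mem_support_depRound {n K : ℕ} {γ : ℝ} (rule : PairRule n) (hK : 1 ≤ K)
    (hKn : K < n) (hγ : 0 < γ) (hγ' : γ < 1) {w : Fin n → ℝ} (hw : ∀ i, 0 < w i)
    {J : Finset (Fin n)} (hJ : J ∈ (depRound rule (selectProb K γ w)).support) : J.card = K := by
  have hp : ∀ i, selectProb K γ w i ∈ Set.Icc (0 : ℝ) 1 := fun i =>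
    ⟨mul_nonneg (by positivity) ((by positivity : 0 ≤ γ / n).trans
      (sampleDist_ge hK hKn hγ' hw i)), selectProb_le_one hK hKn hγ' hw i⟩
  have hs : ∑ i, selectProb K γ w i = K := by
    simp only [selectProb, ← Finset.mul_sum, sum_sampleDist hK hKn hγ' hw, mul_one]
  exact (depRound_spec rule _ hp hs).1 J hJ

/-- The estimate averages exactly `K` vectors, each scaled by `1 / (n q j) ≤ 1 / γ`; hence the bound
is free of `n` and `K`. -/
theorem norm_gradEstimate_le {d n K : ℕ} {γ L : ℝ} (hK : 1 ≤ K) (hKn : K < n) (hγ : 0 < γ)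
    {q : Fin n → ℝ} (hq : ∀ i, γ / n ≤ q i) {ℓ : Fin n → Space d → ℝ} {θ : Space d}
    (hL : ∀ i, ‖gradient (ℓ i) θ‖ ≤ L) {J : Finset (Fin n)} (hJ : J.card = K) :
    ‖gradEstimate K ℓ q J θ‖ ≤ L / γ := by
  have hK0 : (0 : ℝ) < K := by exact_mod_cast hK
  have hn0 : (0 : ℝ) < n := hK0.trans (by exact_mod_cast hKn)
  have hterm : ∀ j ∈ J, ‖(1 / ((n : ℝ) * q j)) • gradient (ℓ j) θ‖ ≤ L / γ := by
    intro j _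
    have h1 : γ ≤ n * q j := by
      have := hq j
      rwa [div_le_iff₀ hn0, mul_comm] at this
    have h0 : 0 ≤ L := (norm_nonneg _).trans (hL j)
    rw [norm_smul, Real.norm_of_nonneg (one_div_nonneg.2 (hγ.le.trans h1)), div_mul_eq_mul_div,
      one_mul]
    have := hL j
    gcongr
  calc ‖gradEstimate K ℓ q J θ‖ ≤ 1 / K * ∑ j ∈ J, L / γ := by
        rw [gradEstimate, norm_smul, Real.norm_of_nonneg (by positivity)]
        gcongr
        exact (norm_sum_le _ _).trans (Finset.sum_le_sum hterm)
    _ = L / γ := by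
        rw [Finset.sum_const, hJ, nsmul_eq_mul]
        field_simp

/-! ### Runs of the algorithm -/

/-- The state after `t` rounds of the run with the batches `B 0, B 1, …`. -/
noncomputable def run {d n : ℕ} (P : Hyper) (ℓ : Fin n → Space d → ℝ) (θ₁ : Space d)
    (B : ℕ → Finset (Fin n)) : ℕ → State d n
  | 0 => initState n θ₁
  | t + 1 => doRound P ℓ (t + 1) (run P ℓ θ₁ B t) (B t)

/-- The gradient estimate of the round `t + 1`. -/
noncomputable def runGrad {d n : ℕ} (P : Hyper) (ℓ : Fin n → Space d → ℝ) (θ₁ : Space d)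
    (B : ℕ → Finset (Fin n)) (t : ℕ) : Space d :=
  gradEstimate P.K ℓ (sampleDist P.K P.γ (run P ℓ θ₁ B t).w) (B t) (run P ℓ θ₁ B t).θ

theorem stateAfter_eq_run {d n : ℕ} (P : Hyper) (ℓ : Fin n → Space d → ℝ) (θ₁ : Space d)
    (B : ℕ → Finset (Fin n)) (t : ℕ) : ∀ J : Fin t → Finset (Fin n), (∀ i, J i = B i) →
      stateAfter P ℓ θ₁ t J = run P ℓ θ₁ B t := by
  induction t with
  | zero => intro J _; rfl
  | succ t ih =>
    intro J hJ
    rw [stateAfter, run, ih _ fun i => hJ i.castSucc, hJ (Fin.last t)]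
    rfl

/-- Causality: a state does not see the batches of later rounds. -/
theorem run_congr {d n : ℕ} (P : Hyper) (ℓ : Fin n → Space d → ℝ) (θ₁ : Space d)
    {B B' : ℕ → Finset (Fin n)} (t : ℕ) (h : ∀ s < t, B s = B' s) :
    run P ℓ θ₁ B t = run P ℓ θ₁ B' t := by
  induction t with
  | zero => rfl
  | succ t ih => rw [run, run, ih fun s hs => h s (by omega), h t (by omega)]

theorem weight_pos {d n : ℕ} (P : Hyper) (ℓ : Fin n → Space d → ℝ) (θ₁ : Space d)
    (B : ℕ → Finset (Fin n)) (t : ℕ) (i : Fin n) : 0 < (run P ℓ θ₁ B t).w i := by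
  induction t with
  | zero => exact one_pos
  | succ t ih =>
    change 0 < weightUpdate _ _ _ _ _ _ _ _ _
    unfold weightUpdate
    split_ifs
    · exact ih
    · exact mul_pos ih (Real.exp_pos _)

/-- The sequence of batches that starts with `J`. -/
def extend {n T : ℕ} (J : Fin T → Finset (Fin n)) (t : ℕ) : Finset (Fin n) :=
  -- The default is arbitrary: the first `T` rounds read only indices below `T`.
  if h : t < T then J ⟨t, h⟩ else ∅

theorem extend_apply {n T : ℕ} (J : Fin T → Finset (Fin n)) (i : Fin T) : extend J i = J i :=
  dif_pos i.isLt

theorem extend_snoc_of_lt {n T : ℕ} (J : Fin T → Finset (Fin n)) (b : Finset (Fin n)) {s : ℕ}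
    (hs : s < T) : extend (Fin.snoc (α := fun _ => Finset (Fin n)) J b) s = extend J s := by
  have h1 := extend_apply (Fin.snoc (α := fun _ => Finset (Fin n)) J b) (Fin.castSucc ⟨s, hs⟩)
  rw [Fin.snoc_castSucc] at h1
  exact h1.trans (extend_apply J ⟨s, hs⟩).symm

theorem extend_snoc_self {n T : ℕ} (J : Fin T → Finset (Fin n)) (b : Finset (Fin n)) :
    extend (Fin.snoc (α := fun _ => Finset (Fin n)) J b) T = b := by
  have h1 := extend_apply (Fin.snoc (α := fun _ => Finset (Fin n)) J b) (Fin.last T)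
  rwa [Fin.snoc_last] at h1

theorem iterate_eq_run {d n T : ℕ} (P : Hyper) (ℓ : Fin n → Space d → ℝ) (θ₁ : Space d)
    (J : Fin T → Finset (Fin n)) (s : Fin T) :
    iterate P ℓ θ₁ J s = (run P ℓ θ₁ (extend J) s).θ := by
  rw [iterate, stateAfter_eq_run P ℓ θ₁ (extend J)]
  exact fun i => (extend_apply J (Fin.castLE s.isLt.le i)).symm

theorem card_batch_eq {d n : ℕ} (P : Hyper) (ℓ : Fin n → Space d → ℝ) (θ₁ : Space d)
    (rule : PairRule n) (hK : 1 ≤ P.K) (hKn : P.K < n) (hγ : 0 < P.γ) (hγ' : P.γ < 1) (T : ℕ) :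
    ∀ J ∈ (batchLaw P ℓ θ₁ rule T).support, ∀ t < T, (extend J t).card = P.K := by
  induction T with
  | zero => intro J _ t ht; omega
  | succ T ih =>
    intro J hJ t ht
    rw [batchLaw, PMF.mem_support_bind_iff] at hJ
    obtain ⟨J', hJ', hJ⟩ := hJ
    rw [PMF.mem_support_map_iff] at hJ
    obtain ⟨b, hb, rfl⟩ := hJ
    rcases Nat.lt_succ_iff_lt_or_eq.1 ht with h | rfl
    · rw [extend_snoc_of_lt J' b h]
      exact ih J' hJ' t h
    · rw [extend_snoc_self]
      rw [stateAfter_eq_run P ℓ θ₁ (extend J') t J' fun i => (extend_apply J' i).symm] at hb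
      exact card_eq_of_mem_support_depRound rule hK hKn hγ hγ' (weight_pos _ _ _ _ _) hb

/-- Along a run, the gradient estimates and the gradients of the empirical risk have the same
expected correlation with the iterates. -/
theorem expect_sum_inner_runGrad {d n : ℕ} (P : Hyper) (ℓ : Fin n → Space d → ℝ)
    (θ₁ y : Space d) (rule : PairRule n) (hK : 1 ≤ P.K) (hKn : P.K < n) (hγ : 0 < P.γ)
    (hγ' : P.γ < 1) (T : ℕ) :
    expect (batchLaw P ℓ θ₁ rule T) (fun J => ∑ t ∈ Finset.range T,
      ⟪runGrad P ℓ θ₁ (extend J) t, (run P ℓ θ₁ (extend J) t).θ - y⟫) =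
    expect (batchLaw P ℓ θ₁ rule T) (fun J => ∑ t ∈ Finset.range T,
      1 / (n : ℝ) * ∑ i, ⟪gradient (ℓ i) (run P ℓ θ₁ (extend J) t).θ,
        (run P ℓ θ₁ (extend J) t).θ - y⟫) := by
  induction T with
  | zero => simp
  | succ T ih =>
    have hrun : ∀ (J : Fin T → Finset (Fin n)) (b : Finset (Fin n)), ∀ t ≤ T,
        run P ℓ θ₁ (extend (Fin.snoc (α := fun _ => Finset (Fin n)) J b)) t =
          run P ℓ θ₁ (extend J) t := fun J b t ht =>
      run_congr P ℓ θ₁ t fun s hs => extend_snoc_of_lt J b (by omega)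
    have hgrad : ∀ (J : Fin T → Finset (Fin n)) (b : Finset (Fin n)), ∀ t < T,
        runGrad P ℓ θ₁ (extend (Fin.snoc (α := fun _ => Finset (Fin n)) J b)) t =
          runGrad P ℓ θ₁ (extend J) t := fun J b t ht => by
      rw [runGrad, runGrad, hrun J b t ht.le, extend_snoc_of_lt J b ht]
    simp only [batchLaw, expect_bind, expect_map, Finset.sum_range_succ]
    have hleft : ∀ (J : Fin T → Finset (Fin n)) (b : Finset (Fin n)),
        ∑ t ∈ Finset.range T,
          ⟪runGrad P ℓ θ₁ (extend (Fin.snoc (α := fun _ => Finset (Fin n)) J b)) t,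
            (run P ℓ θ₁ (extend (Fin.snoc (α := fun _ => Finset (Fin n)) J b)) t).θ - y⟫ =
        ∑ t ∈ Finset.range T,
          ⟪runGrad P ℓ θ₁ (extend J) t, (run P ℓ θ₁ (extend J) t).θ - y⟫ := fun J b =>
      Finset.sum_congr rfl fun t ht => by
        rw [hgrad J b t (Finset.mem_range.1 ht), hrun J b t (Finset.mem_range.1 ht).le]
    have hright : ∀ (J : Fin T → Finset (Fin n)) (b : Finset (Fin n)),
        ∑ t ∈ Finset.range T, 1 / (n : ℝ) * ∑ i, ⟪gradient (ℓ i)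
            (run P ℓ θ₁ (extend (Fin.snoc (α := fun _ => Finset (Fin n)) J b)) t).θ,
          (run P ℓ θ₁ (extend (Fin.snoc (α := fun _ => Finset (Fin n)) J b)) t).θ - y⟫ =
        ∑ t ∈ Finset.range T, 1 / (n : ℝ) * ∑ i, ⟪gradient (ℓ i) (run P ℓ θ₁ (extend J) t).θ,
          (run P ℓ θ₁ (extend J) t).θ - y⟫ := fun J b =>
      Finset.sum_congr rfl fun t ht => by rw [hrun J b t (Finset.mem_range.1 ht).le]
    have hlast : ∀ (J : Fin T → Finset (Fin n)) (b : Finset (Fin n)),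
        runGrad P ℓ θ₁ (extend (Fin.snoc (α := fun _ => Finset (Fin n)) J b)) T =
          gradEstimate P.K ℓ (sampleDist P.K P.γ (run P ℓ θ₁ (extend J) T).w) b
            (run P ℓ θ₁ (extend J) T).θ := fun J b => by
      rw [runGrad, hrun J b T le_rfl, extend_snoc_self]
    simp only [hleft, hright, hlast, hrun _ _ T le_rfl, expect_add, expect_const]
    -- Given the earlier batches `J`, the last iterate and its weights are fixed, so only the newest
    -- batch is averaged in the remaining term.
    rw [ih]
    congr 1
    congr 1
    funext J
    rw [stateAfter_eq_run P ℓ θ₁ (extend J) T J fun i => (extend_apply J i).symm]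
    exact expect_gradEstimate rule hK hKn hγ hγ' (weight_pos _ _ _ _ _) ℓ _ _

/-- The linearised regret of Adam along a single run. -/
theorem sum_inner_runGrad_le {d n T : ℕ} {P : Hyper} {ℓ : Fin n → Space d → ℝ} {θ₁ y : Space d}
    {B : ℕ → Finset (Fin n)} {G R : ℝ} (hα : 0 < P.α) (hβ0 : 0 ≤ P.β₁) (hβ1 : P.β₁ < 1)
    (hβ₂ : 0 ≤ P.β₂) (hβ₂' : P.β₂ < 1) (hr0 : 0 < P.lam) (hr1 : P.lam < 1) (hε : 0 < P.ε)
    (hG : 0 ≤ G) (hR : 0 ≤ R) (hg : ∀ t < T, ‖runGrad P ℓ θ₁ B t‖ ≤ G)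
    (hxy : ∀ t < T, ‖(run P ℓ θ₁ B t).θ - y‖ ≤ R) :
    ∑ t ∈ Finset.range T, ⟪runGrad P ℓ θ₁ B t, (run P ℓ θ₁ B t).θ - y⟫ ≤
      d * (√(T : ℝ) * (G / (1 - P.β₁) + P.ε) / (2 * P.α) * R ^ 2 +
        P.α * G ^ 2 / P.ε * √(T : ℝ) + 2 * G * R * (P.β₁ * (1 / (1 - P.lam)))) := by
  have hcoord : ∀ u, ∑ t ∈ Finset.range T, runGrad P ℓ θ₁ B t u * ((run P ℓ θ₁ B t).θ u - y u) ≤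
      √(T : ℝ) * (G / (1 - P.β₁) + P.ε) / (2 * P.α) * R ^ 2 +
        P.α * G ^ 2 / P.ε * √(T : ℝ) + 2 * G * R * (P.β₁ * (1 / (1 - P.lam))) := by
    intro u
    -- Each coordinate is charged the full Euclidean bounds; this produces the factor `d`.
    have hgu : ∀ t < T, |runGrad P ℓ θ₁ B t u| ≤ G := fun t ht =>
      (PiLp.norm_apply_le (runGrad P ℓ θ₁ B t) u).trans (hg t ht)
    have hxu : ∀ t < T, |(run P ℓ θ₁ B t).θ u - y u| ≤ R := fun t ht =>
      (PiLp.norm_apply_le ((run P ℓ θ₁ B t).θ - y) u).trans (hxy t ht)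
    obtain ⟨hmono, hbound⟩ := vhat_spec hβ0 hβ1 hr0 hr1 hβ₂ hβ₂'
      (g := fun t => runGrad P ℓ θ₁ B t u) (v := fun t => (run P ℓ θ₁ B t).v u)
      (vhat := fun t => (run P ℓ θ₁ B t).vhat u) rfl (fun t => rfl) rfl (fun t => by
        simp [run, doRound, Hyper.decay])
    refine momentum_regret_le (m := fun t => (run P ℓ θ₁ B t).m u)
      (g := fun t => runGrad P ℓ θ₁ B t u) (x := fun t => (run P ℓ θ₁ B t).θ u)
      (A := fun t => √((run P ℓ θ₁ B t).vhat u) + P.ε) hα hε hG hR hβ0 hβ1 hr0 hr1 rfl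
      (fun t => ?_) (fun t => ?_) (fun s t hst => ?_) (fun t => ?_) ?_ hgu hxu
    · simp [run, doRound, Hyper.decay, runGrad]
    · simp [run, doRound, Hyper.step]
    · exact add_le_add_left (Real.sqrt_le_sqrt (hmono hst)) _
    · exact le_add_of_nonneg_left (Real.sqrt_nonneg _)
    · refine add_le_add_left (Real.sqrt_le_iff.2 ⟨div_nonneg hG (by linarith), ?_⟩) _
      exact hbound T G hgu
  calc ∑ t ∈ Finset.range T, ⟪runGrad P ℓ θ₁ B t, (run P ℓ θ₁ B t).θ - y⟫
      = ∑ u, ∑ t ∈ Finset.range T, runGrad P ℓ θ₁ B t u * ((run P ℓ θ₁ B t).θ u - y u) := by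
        rw [Finset.sum_comm]
        simp [PiLp.inner_apply, mul_comm]
    _ ≤ _ := by
        refine (Finset.sum_le_sum fun u _ => hcoord u).trans (le_of_eq ?_)
        rw [Finset.sum_const, Finset.card_univ, Fintype.card_fin, nsmul_eq_mul]

end AdamCB

/-! ### The regret bound -/

theorem theorem1 (α β₁ β₂ lam γ ε L D : ℝ) (hα : 0 < α) (hβ₁ : 0 ≤ β₁) (hβ₁' : β₁ < 1)
    (hβ₂ : 0 ≤ β₂) (hβ₂' : β₂ < 1) (hlam : 0 < lam) (hlam' : lam < 1) (hγ : 0 < γ) (hγ' : γ < 1)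
    (hε : 0 < ε) (hL : 0 < L) (hD : 0 < D) :
    ∃ C : ℝ, 0 < C ∧
      ∀ (d n K T : ℕ), 1 ≤ d → 1 ≤ K → K < n → 1 ≤ T →
      ∀ (ℓ : Fin n → AdamCB.Space d → ℝ) (θ₁ θstar : AdamCB.Space d) (rule : AdamCB.PairRule n),
        (∀ i, ConvexOn ℝ Set.univ (ℓ i)) →
        (∀ i, Differentiable ℝ (ℓ i)) →
        (∀ θ, AdamCB.empiricalRisk ℓ θstar ≤ AdamCB.empiricalRisk ℓ θ) →
        ‖θ₁ - θstar‖ ≤ D →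
        AdamCB.BoundedGradients ⟨α, β₁, β₂, lam, γ, ε, L, K⟩ ℓ θ₁ rule T L →
        AdamCB.BoundedIterates ⟨α, β₁, β₂, lam, γ, ε, L, K⟩ ℓ θ₁ rule T D →
        AdamCB.regret ⟨α, β₁, β₂, lam, γ, ε, L, K⟩ ℓ θ₁ rule T ≤
          C * (d * √(T : ℝ) +
            √(d : ℝ) / (n : ℝ) ^ (3 / 4 : ℝ) *
              ((T : ℝ) / K * Real.log ((n : ℝ) / K)) ^ (1 / 4 : ℝ)) := by

  set G : ℝ := L / γ with hG
  have hG0 : 0 < G := by positivity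
  have h1β : 0 < 1 - β₁ := by linarith
  have h1r : 0 < 1 - lam := by linarith
  -- The three terms of the one-dimensional bound, with `√T` taken out. The radius is `2 * D`
  -- because iterates are compared with `θstar` through `θ₁`.
  set C : ℝ := (G / (1 - β₁) + ε) / (2 * α) * (2 * D) ^ 2 + α * G ^ 2 / ε +
    2 * G * (2 * D) * (β₁ * (1 / (1 - lam))) with hC
  have hC0 : 0 < C := by positivity
  refine ⟨C, hC0, fun d n K T _ hK hKn hT ℓ θ₁ θstar rule hconv hdiff hmin hθ₁ hgrad hiter => ?_⟩
  set P : AdamCB.Hyper := ⟨α, β₁, β₂, lam, γ, ε, L, K⟩ with hP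
  have hinf : ⨅ θ, AdamCB.empiricalRisk ℓ θ = AdamCB.empiricalRisk ℓ θstar :=
    le_antisymm (ciInf_le ⟨_, by rintro _ ⟨θ, rfl⟩; exact hmin θ⟩ θstar) (le_ciInf hmin)
  have hlin : AdamCB.regret P ℓ θ₁ rule T ≤ AdamCB.expect (AdamCB.batchLaw P ℓ θ₁ rule T)
      (fun J => ∑ t ∈ Finset.range T, 1 / (n : ℝ) * ∑ i,
        inner ℝ (gradient (ℓ i) (AdamCB.run P ℓ θ₁ (AdamCB.extend J) t).θ)
          ((AdamCB.run P ℓ θ₁ (AdamCB.extend J) t).θ - θstar)) := by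
    refine AdamCB.expect_mono _ fun J _ => ?_
    rw [hinf, Finset.sum_range]
    calc _ = ∑ s : Fin T, (AdamCB.empiricalRisk ℓ (AdamCB.iterate P ℓ θ₁ J s) -
          AdamCB.empiricalRisk ℓ θstar) := by
          simp [Finset.sum_sub_distrib]
      _ ≤ _ := Finset.sum_le_sum fun s _ => by
          rw [AdamCB.iterate_eq_run]
          exact AdamCB.empiricalRisk_sub_le hconv hdiff _ _
  rw [← AdamCB.expect_sum_inner_runGrad P ℓ θ₁ θstar rule hK hKn hγ hγ' T] at hlin
  have hsqrt : 1 ≤ √(T : ℝ) := Real.one_le_sqrt.2 (by exact_mod_cast hT)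
  have hpath : AdamCB.regret P ℓ θ₁ rule T ≤ C * (d * √(T : ℝ)) := by
    refine hlin.trans ((AdamCB.expect_mono _ fun J hJ => ?_).trans_eq (AdamCB.expect_const _ _))
    have hg : ∀ t < T, ‖AdamCB.runGrad P ℓ θ₁ (AdamCB.extend J) t‖ ≤ G := fun t ht => by
      refine AdamCB.norm_gradEstimate_le hK hKn hγ
        (AdamCB.sampleDist_ge hK hKn hγ' (AdamCB.weight_pos _ _ _ _ _)) (fun i => ?_)
        (AdamCB.card_batch_eq P ℓ θ₁ rule hK hKn hγ hγ' T J hJ t ht)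
      have := hgrad J hJ ⟨t, ht⟩ i
      rwa [AdamCB.iterate_eq_run] at this
    have hx : ∀ t < T, ‖(AdamCB.run P ℓ θ₁ (AdamCB.extend J) t).θ - θstar‖ ≤ 2 * D :=
      fun t ht => by
        have h := hiter J hJ ⟨t, ht⟩ ⟨0, hT⟩
        rw [AdamCB.iterate_eq_run, AdamCB.iterate_eq_run] at h
        calc _ ≤ _ := norm_sub_le_norm_sub_add_norm_sub _ θ₁ _
          _ ≤ D + D := add_le_add h hθ₁
          _ = 2 * D := by ring
    refine (AdamCB.sum_inner_runGrad_le hα hβ₁ hβ₁' hβ₂ hβ₂' hlam hlam' hε hG0.le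
      (by positivity) hg hx).trans ?_
    -- The momentum term does not grow with `T`; it is absorbed using `1 ≤ √T`.
    have hlast : 2 * G * (2 * D) * (β₁ * (1 / (1 - lam))) ≤
        2 * G * (2 * D) * (β₁ * (1 / (1 - lam))) * √(T : ℝ) :=
      le_mul_of_one_le_right (by positivity) hsqrt
    calc _ ≤ (d : ℝ) * (√(T : ℝ) * (G / (1 - β₁) + ε) / (2 * α) * (2 * D) ^ 2 +
          α * G ^ 2 / ε * √(T : ℝ) + 2 * G * (2 * D) * (β₁ * (1 / (1 - lam))) * √(T : ℝ)) := by
          gcongr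
      _ = C * (d * √(T : ℝ)) := by rw [hC]; ring
  -- The second term of the bound is nonnegative because `K < n` makes the logarithm so.
  refine hpath.trans (mul_le_mul_of_nonneg_left (le_add_of_nonneg_right ?_) hC0.le)
  have hK0 : (0 : ℝ) < K := by exact_mod_cast hK
  have hlog : 0 ≤ Real.log ((n : ℝ) / K) :=
    Real.log_nonneg ((one_le_div hK0).2 (by exact_mod_cast hKn.le))
  positivity
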